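/- All graphs are finite, may have multiple edges, and have no loops; every edge is a resistor of unit resistance. $R_{xy}$ denotes the effective resistance between the vertices $x$ and $y$ ($R_{xy}=\infty$ if no path joins $x$ and $y$), and $e(G)$ is the number of edges of $G$, counted with multiplicity. For a graph $G$ on $n$ vertices put \[A'(G)=\frac1{n^2}\sum_{x,y\in V(G)}R_{xy},\] and for a graph $G$ with a distinguished root vertex $\rho$ put \[B(G)=\frac1{|V(G)|-1}\sum_{x\in V(G)}R_{\rho x}.\] For real $\alpha$ and $n\in\mathbb N$ let \[a_n(\alpha)=\min\{A'(G):|V(G)|=n,\ e(G)\le \alpha n/2\},\qquad b_n(\alpha)=\min\{B(G):G\text{ rooted},\ |V(G)|=n+1,\ e(G)\le \alpha n/2\},\] and let $a(\alpha)=\lim_{n\to\infty}a_n(\alpha)$ and $b(\alpha)=\lim_{n\to\infty}b_n(\alpha)$. Corollary. For every integer $\alpha\ge 3$ the limits $b(\alpha)$ and $a(\alpha)$ exist, and \[b(\alpha)\le\frac{\alpha-1}{\alpha(\alpha-2)}\qquad\text{and}\qquad a(\alpha)\le\frac{2(\alpha-1)}{\alpha(\alpha-2)}.\] -/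

import Mathlib

open scoped ENNReal
open Filter Topology

namespace ResistorNetwork

/-- A finite graph on the vertex set `V`, multiple edges allowed (no loops): a finite multiset of
unordered pairs of distinct vertices. Every edge has unit resistance. -/
structure Multigraph (V : Type*) where
  /-- The multiset of edges. -/
  edges : Multiset (Sym2 V)
  loopless : ∀ e ∈ edges, ¬ e.IsDiag

namespace Multigraph

variable {V : Type*}

/-- The number `e(G)` of edges, counted with multiplicity. -/
def edgeCount (G : Multigraph V) : ℕ := Multiset.card G.edges

variable [DecidableEq V]

/-- The number of parallel edges joining `x` and `y`. -/
def mult (G : Multigraph V) (x y : V) : ℕ := G.edges.count s(x, y)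

variable [Fintype V]

/-- `p` is a system of potentials for a current flow of size `1` from `x` to `y`. By Ohm's law each
edge from `u` to `w` carries the current `p u - p w`, which is the potential law. The current law
says that the net current out of `u` into the network vanishes, except that a unit current
enters the network at `x` and leaves it at `y`. -/
def IsUnitPotential (G : Multigraph V) (x y : V) (p : V → ℝ) : Prop :=
  ∀ u, ∑ w, (G.mult u w : ℝ) * (p u - p w) = (if u = x then 1 else 0) - (if u = y then 1 else 0)

/-- The effective resistance `R_{xy}`: the potential difference `p x - p y` in a unit current flow
from `x` to `y`, and `∞` if there is no such flow, that is, if `x` and `y` are not connected by a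
path. All unit current flows give the same difference (`effectiveResistance_eq` below), so the
infimum is over at most one value. -/
noncomputable def effectiveResistance (G : Multigraph V) (x y : V) : ℝ≥0∞ :=
  ⨅ (p : V → ℝ) (_ : G.IsUnitPotential x y p), ENNReal.ofReal (p x - p y)

theorem IsUnitPotential.sum_mul {G : Multigraph V} {x y : V} {p : V → ℝ}
    (hp : G.IsUnitPotential x y p) (q : V → ℝ) :
    ∑ u, ∑ w, q u * ((G.mult u w : ℝ) * (p u - p w)) = q x - q y := by
  have h : ∀ u, ∑ w, q u * ((G.mult u w : ℝ) * (p u - p w))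
      = q u * ((if u = x then 1 else 0) - (if u = y then 1 else 0)) := by
    intro u
    rw [← hp u, Finset.mul_sum]
  rw [Finset.sum_congr rfl fun u _ => h u]
  simp [mul_sub]

theorem IsUnitPotential.sub_eq {G : Multigraph V} {x y : V} {p q : V → ℝ}
    (hp : G.IsUnitPotential x y p) (hq : G.IsUnitPotential x y q) : p x - p y = q x - q y := by
  have hc : ∀ u w, G.mult u w = G.mult w u := fun u w => by simp [mult, Sym2.eq_swap]
  have key : ∀ r s : V → ℝ, ∑ u, ∑ w, r u * ((G.mult u w : ℝ) * (s u - s w))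
      = ∑ u, ∑ w, (G.mult u w : ℝ) * (r u * s u) - ∑ u, ∑ w, (G.mult u w : ℝ) * (r u * s w) := by
    intro r s
    simp only [← Finset.sum_sub_distrib]
    refine Finset.sum_congr rfl fun u _ => Finset.sum_congr rfl fun w _ => by ring
  rw [← hq.sum_mul p, ← hp.sum_mul q, key, key]
  congr 1
  · refine Finset.sum_congr rfl fun u _ => Finset.sum_congr rfl fun w _ => by ring
  · rw [Finset.sum_comm]
    refine Finset.sum_congr rfl fun u _ => Finset.sum_congr rfl fun w _ => by rw [hc]; ring

/-- The effective resistance is well defined: any unit current flow computes it. -/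
theorem effectiveResistance_eq {G : Multigraph V} {x y : V} {p : V → ℝ}
    (hp : G.IsUnitPotential x y p) : G.effectiveResistance x y = ENNReal.ofReal (p x - p y) := by
  refine le_antisymm (iInf₂_le p hp) (le_iInf₂ fun q hq => ?_)
  rw [hp.sub_eq hq]

/-- `A'(G) = (1/n²) ∑_{x,y} R_{xy}`, the average resistance over all ordered pairs of vertices
of a graph with `n` vertices. -/
noncomputable def avgResistance (G : Multigraph V) : ℝ≥0∞ :=
  (∑ x, ∑ y, G.effectiveResistance x y) / (Fintype.card V : ℝ≥0∞) ^ 2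

/-- `B(G) = (1/(|V(G)|-1)) ∑_x R_{ρx}`, the average resistance of the non-root vertices to the root
`ρ`. -/
noncomputable def rootedAvgResistance (G : Multigraph V) (ρ : V) : ℝ≥0∞ :=
  (∑ x, G.effectiveResistance ρ x) / ((Fintype.card V : ℝ≥0∞) - 1)

end Multigraph

/-- `a_n(α)`: the minimum of `A'(G)` over all graphs `G` with `n` vertices and at most `αn/2` edges.
There are only finitely many such graphs, so the infimum is a minimum whenever there is one
at all. -/
noncomputable def aSeq (n : ℕ) (α : ℝ) : ℝ≥0∞ :=
  ⨅ (G : Multigraph (Fin n)) (_ : (G.edgeCount : ℝ) ≤ α * n / 2), G.avgResistance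

/-- `b_n(α)`: the minimum of `B(G)` over all rooted graphs `G` with `n` non-root vertices (so `n + 1`
vertices in all) and at most `αn/2` edges. -/
noncomputable def bSeq (n : ℕ) (α : ℝ) : ℝ≥0∞ :=
  ⨅ (G : Multigraph (Fin (n + 1))) (ρ : Fin (n + 1)) (_ : (G.edgeCount : ℝ) ≤ α * n / 2),
    G.rootedAvgResistance ρ

/-- `a(α) = lim_{n → ∞} a_n(α)` (meaningful where the limit exists). -/
noncomputable def a (α : ℝ) : ℝ≥0∞ := limUnder atTop fun n => aSeq n α

/-- `b(α) = lim_{n → ∞} b_n(α)` (meaningful where the limit exists). -/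
noncomputable def b (α : ℝ) : ℝ≥0∞ := limUnder atTop fun n => bSeq n α

end ResistorNetwork

/-! The potential of a unit current from `x` to `y` represents the functional `f ↦ f x - f y` with
respect to the Dirichlet energy `E f = ∑_{uw} (f u - f w) ^ 2` (`sum_mul_laplacian`). Hence the
effective resistance is the least `c` with `(f x - f y) ^ 2 ≤ c * E f` for all `f`
(`effectiveResistance_le`), and in a connected graph resistances are squared distances in a
Euclidean space (`exists_embedding`).

Existence of `b(α)`: gluing two rooted graphs at their roots shows that `n * b_n(α)` is subadditive,
so by Fekete's lemma `b_n(α)` converges to its infimum (`exists_tendsto_bSeq`).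

Existence of `a(α)`: in fact `a(α) = 2 b(α)` (`tendsto_aSeq`). The mean squared distance in a
Hilbert space is at most twice the mean squared distance from a fixed point, so `a_{n+1} ≤ 2 b_n`.
Conversely, twice the variance is the mean squared distance, and the mean of `k` well chosen points
is almost as good a centre as the barycentre; joining these `k` vertices to a new root turns a graph
with average resistance `A` into a rooted graph with average resistance about `A / 2`. The surplus
edges are paid for by additional leaves at the root (`bTotal_le_of_surplus`).

Upper bound: `(α - 1) / (α (α - 2))` is the resistance from the root to infinity in the `α`-regular
tree. Since `b(α)` is an infimum, a single family of graphs suffices: `α`-regular graphs that look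
like the tree up to a large radius `r`, in which a small proportion of the vertices, meeting every
ball of some radius `l`, is joined to the root. The current from a vertex first spreads evenly over
the sphere of radius `r`, which costs at most the resistance of the tree
(`sq_sub_sphere_average_le`), and then runs to the root, which costs little as `r → ∞` because of a
Poincaré inequality whose constant depends only on `α` and `l` (`sum_sq_sub_root_le`). The local tree
structure comes from permutations of a ball of the tree that move each vertex along its edge of a
given colour: a reduced word of length at most `r` can be read off from the image of the centre under
the corresponding product of permutations (`wordAct_treeMove_apply`). -/

namespace ResistorNetwork

namespace Multigraph

/-! ### Dirichlet energy and operations on graphs -/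

section Energy

variable {V W : Type*}

/-- The squared potential difference of `f` across an unordered pair. -/
def sqDiff (f : V → ℝ) : Sym2 V → ℝ :=
  Sym2.lift ⟨fun u w => (f u - f w) ^ 2, fun u w => by ring⟩

@[simp] theorem sqDiff_mk (f : V → ℝ) (u w : V) : sqDiff f s(u, w) = (f u - f w) ^ 2 := rfl

theorem sqDiff_nonneg (f : V → ℝ) (e : Sym2 V) : 0 ≤ sqDiff f e := by
  induction e with
  | h u w => simp only [sqDiff_mk]; positivity

theorem sqDiff_map (φ : V → W) (f : W → ℝ) (e : Sym2 V) :
    sqDiff f (Sym2.map φ e) = sqDiff (f ∘ φ) e := by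
  induction e with
  | h u w => simp

/-- The Dirichlet energy of `f`: the sum over all edges of the squared potential difference. -/
def energy (G : Multigraph V) (f : V → ℝ) : ℝ := (G.edges.map (sqDiff f)).sum

theorem energy_nonneg (G : Multigraph V) (f : V → ℝ) : 0 ≤ G.energy f := by
  refine Multiset.sum_nonneg fun a ha => ?_
  obtain ⟨e, -, rfl⟩ := Multiset.mem_map.1 ha
  exact sqDiff_nonneg f e

/-- The union, with multiplicities, of two graphs on the same vertex set. -/
def union (G H : Multigraph V) : Multigraph V where
  edges := G.edges + H.edges
  loopless e he := (Multiset.mem_add.1 he).elim (G.loopless e) (H.loopless e)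

@[simp] theorem energy_union (G H : Multigraph V) (f : V → ℝ) :
    (G.union H).energy f = G.energy f + H.energy f := by
  simp [energy, union]

@[simp] theorem edgeCount_union (G H : Multigraph V) :
    (G.union H).edgeCount = G.edgeCount + H.edgeCount := by
  simp [edgeCount, union]

/-- The image of a graph under an injective map of vertices. -/
def map (G : Multigraph V) (φ : V ↪ W) : Multigraph W where
  edges := G.edges.map (Sym2.map φ)
  loopless e he := by
    obtain ⟨e', he', rfl⟩ := Multiset.mem_map.1 he
    rw [Sym2.isDiag_map φ.injective]
    exact G.loopless e' he'

@[simp] theorem energy_map (G : Multigraph V) (φ : V ↪ W) (f : W → ℝ) :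
    (G.map φ).energy f = G.energy (f ∘ φ) := by
  simp only [energy, map, Multiset.map_map]
  exact congrArg _ (Multiset.map_congr rfl fun e _ => sqDiff_map φ f e)

@[simp] theorem edgeCount_map (G : Multigraph V) (φ : V ↪ W) :
    (G.map φ).edgeCount = G.edgeCount := by
  simp [edgeCount, map]

/-- The graph on `Option V` with one edge from the root `none` to `s j` for each `j`. -/
def spokes {ι : Type*} [Fintype ι] (s : ι → V) : Multigraph (Option V) where
  edges := (Finset.univ : Finset ι).val.map fun j => s(none, some (s j))
  loopless e he := by
    obtain ⟨j, -, rfl⟩ := Multiset.mem_map.1 he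
    simp

@[simp] theorem edgeCount_spokes {ι : Type*} [Fintype ι] (s : ι → V) :
    (spokes s).edgeCount = Fintype.card ι := by
  simp [edgeCount, spokes]

@[simp] theorem energy_spokes {ι : Type*} [Fintype ι] (s : ι → V) (f : Option V → ℝ) :
    (spokes s).energy f = ∑ j, (f none - f (some (s j))) ^ 2 := by
  simp [energy, spokes]

/-- The simple graph with a given set of edges. -/
def ofFinset (S : Finset (Sym2 V)) (hS : ∀ e ∈ S, ¬ e.IsDiag) : Multigraph V where
  edges := S.val
  loopless := hS

theorem energy_ofFinset (S : Finset (Sym2 V)) (hS : ∀ e ∈ S, ¬ e.IsDiag) (f : V → ℝ) :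
    (ofFinset S hS).energy f = ∑ e ∈ S, sqDiff f e := rfl

theorem edgeCount_ofFinset (S : Finset (Sym2 V)) (hS : ∀ e ∈ S, ¬ e.IsDiag) :
    (ofFinset S hS).edgeCount = S.card := rfl

end Energy

/-! ### Effective resistance as a best constant, and the Hilbert space embedding -/

section Resistance

variable {V W : Type*} [DecidableEq V] [Fintype V] [DecidableEq W] [Fintype W]

theorem sum_count_mul_sqDiff (s : Multiset (Sym2 V)) (f : V → ℝ) :
    ∑ u, ∑ w, (s.count s(u, w) : ℝ) * (f u - f w) ^ 2 = 2 * (s.map (sqDiff f)).sum := by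
  induction s using Multiset.induction_on with
  | empty => simp
  | cons e s ih =>
    simp only [Multiset.count_cons, Nat.cast_add, add_mul, Finset.sum_add_distrib, ih,
      Multiset.map_cons, Multiset.sum_cons, mul_add]
    rw [add_comm]
    congr 1
    induction e with
    | h x y =>
      by_cases hxy : x = y
      · subst hxy
        have : ∀ u w : V, ((if s(u, w) = s(x, x) then 1 else 0 : ℕ) : ℝ) * (f u - f w) ^ 2 = 0 := by
          intro u w
          split_ifs with h
          · simp only [Sym2.eq_iff, or_self] at h
            simp [h.1, h.2]
          · simp
        rw [Finset.sum_eq_zero fun u _ => Finset.sum_eq_zero fun w _ => this u w]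
        simp
      · have : ∀ u w : V, ((if s(u, w) = s(x, y) then 1 else 0 : ℕ) : ℝ) * (f u - f w) ^ 2
            = (if u = x then if w = y then (f x - f y) ^ 2 else 0 else 0)
              + (if u = y then if w = x then (f x - f y) ^ 2 else 0 else 0) := by
          intro u w
          simp only [Sym2.eq_iff]
          by_cases h1 : u = x
          · subst h1
            by_cases h2 : w = y <;> simp [h2, hxy]
          · by_cases h2 : u = y
            · subst h2
              by_cases h3 : w = x
              · subst h3
                simp [h1]; ring
              · simp [h1, h3]
            · simp [h1, h2]
        simp only [this, Finset.sum_add_distrib]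
        simp
        ring

/-- The gradient of `f`, with a coordinate for each ordered pair of vertices. Each edge is counted
in both directions, which the factor `1 / 2` under the root makes up for. -/
noncomputable def grad (G : Multigraph V) : (V → ℝ) →ₗ[ℝ] EuclideanSpace ℝ (V × V) where
  toFun f := WithLp.toLp 2 fun e => √((G.mult e.1 e.2 : ℝ) / 2) * (f e.1 - f e.2)
  map_add' f g := by ext e; simp; ring
  map_smul' c f := by ext e; simp; ring

theorem inner_grad (G : Multigraph V) (f g : V → ℝ) :
    inner ℝ (G.grad f) (G.grad g)
      = (∑ u, ∑ w, (G.mult u w : ℝ) * ((f u - f w) * (g u - g w))) / 2 := by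
  simp only [grad, PiLp.inner_apply, LinearMap.coe_mk, AddHom.coe_mk, Fintype.sum_prod_type,
    Finset.sum_div]
  refine Finset.sum_congr rfl fun u _ => Finset.sum_congr rfl fun w _ => ?_
  have h : √((G.mult u w : ℝ) / 2) * √((G.mult u w : ℝ) / 2) = (G.mult u w : ℝ) / 2 :=
    Real.mul_self_sqrt (by positivity)
  simp only [RCLike.inner_apply, conj_trivial]
  linear_combination ((f u - f w) * (g u - g w)) * h

theorem norm_grad_sq (G : Multigraph V) (f : V → ℝ) : ‖G.grad f‖ ^ 2 = G.energy f := by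
  have h := sum_count_mul_sqDiff G.edges f
  rw [← real_inner_self_eq_norm_sq, inner_grad]
  simp only [energy, mult, ← pow_two]
  rw [h]; ring

/-- Green's formula. -/
theorem sum_mul_laplacian (G : Multigraph V) (f g : V → ℝ) :
    ∑ u, f u * ∑ w, (G.mult u w : ℝ) * (g u - g w) = inner ℝ (G.grad f) (G.grad g) := by
  have hc : ∀ u w, G.mult u w = G.mult w u := fun u w => by simp [mult, Sym2.eq_swap]
  have h : ∑ u, ∑ w, f u * ((G.mult u w : ℝ) * (g u - g w))
      = ∑ u, ∑ w, f w * ((G.mult u w : ℝ) * (g w - g u)) := by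
    rw [Finset.sum_comm]
    exact Finset.sum_congr rfl fun u _ => Finset.sum_congr rfl fun w _ => by rw [hc]
  have h2 : ∑ u, ∑ w, (G.mult u w : ℝ) * ((f u - f w) * (g u - g w))
      = ∑ u, ∑ w, f u * ((G.mult u w : ℝ) * (g u - g w))
        + ∑ u, ∑ w, f w * ((G.mult u w : ℝ) * (g w - g u)) := by
    simp only [← Finset.sum_add_distrib]
    exact Finset.sum_congr rfl fun u _ => Finset.sum_congr rfl fun w _ => by ring
  rw [inner_grad, h2, ← h]
  simp only [Finset.mul_sum]
  ring

theorem IsUnitPotential.inner_grad {G : Multigraph V} {x y : V} {p : V → ℝ}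
    (hp : G.IsUnitPotential x y p) (f : V → ℝ) :
    inner ℝ (G.grad f) (G.grad p) = f x - f y := by
  rw [← sum_mul_laplacian, ← hp.sum_mul f]
  simp only [Finset.mul_sum]

theorem IsUnitPotential.effectiveResistance_eq_norm {G : Multigraph V} {x y : V} {p : V → ℝ}
    (hp : G.IsUnitPotential x y p) :
    G.effectiveResistance x y = ENNReal.ofReal (‖G.grad p‖ ^ 2) := by
  rw [effectiveResistance_eq hp, ← real_inner_self_eq_norm_sq, hp.inner_grad]

theorem exists_isUnitPotential_of_ne_top {G : Multigraph V} {x y : V}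
    (h : G.effectiveResistance x y ≠ ∞) : ∃ p, G.IsUnitPotential x y p := by
  by_contra hne
  push Not at hne
  exact h (by simp [effectiveResistance, hne])

/-- A unit current flows from `x` to `y` as soon as every function without energy takes the same
value at `x` and `y`: otherwise a linear functional `f` separates `δ_x - δ_y` from the range of the
Laplacian, and such an `f` has no energy. -/
theorem exists_isUnitPotential {G : Multigraph V} {x y : V}
    (h : ∀ f, G.energy f = 0 → f x = f y) : ∃ p, G.IsUnitPotential x y p := by
  let L : (V → ℝ) →ₗ[ℝ] (V → ℝ) :=
    { toFun := fun p u => ∑ w, (G.mult u w : ℝ) * (p u - p w)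
      map_add' := fun p q => by
        ext u
        simp only [Pi.add_apply, ← Finset.sum_add_distrib]
        exact Finset.sum_congr rfl fun w _ => by ring
      map_smul' := fun c p => by
        ext u
        simp only [Pi.smul_apply, smul_eq_mul, RingHom.id_apply, Finset.mul_sum]
        exact Finset.sum_congr rfl fun w _ => by ring }
  let δ : V → ℝ := fun u => (if u = x then 1 else 0) - (if u = y then 1 else 0)
  by_cases hδ : δ ∈ LinearMap.range L
  · obtain ⟨p, hp⟩ := hδ
    exact ⟨p, fun u => congrFun hp u⟩
  · exfalso
    obtain ⟨φ, hφ, hL⟩ := Submodule.exists_le_ker_of_notMem hδ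
    let f : V → ℝ := fun u => φ (Pi.single u 1)
    have hf : ∀ g, φ g = ∑ u, f u * g u := by
      intro g
      rw [LinearMap.pi_apply_eq_sum_univ φ g]
      refine Finset.sum_congr rfl fun u _ => ?_
      rw [smul_eq_mul, mul_comm]
      congr 2
      ext w
      simp [Pi.single_apply, eq_comm]
    have hE : G.energy f = 0 := by
      have h0 : φ (L f) = 0 := hL ⟨f, rfl⟩
      rw [hf] at h0
      rw [← norm_grad_sq, ← real_inner_self_eq_norm_sq, ← sum_mul_laplacian]
      exact h0
    apply hφ
    rw [hf]
    simp [δ, mul_sub, h f hE]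

/-- The effective resistance is the least constant in the Poincaré-type inequality between
`(f x - f y) ^ 2` and the energy of `f`. This is how resistances are bounded from above. -/
theorem effectiveResistance_le {G : Multigraph V} {x y : V} {c : ℝ} (hc : 0 ≤ c)
    (h : ∀ f, (f x - f y) ^ 2 ≤ c * G.energy f) :
    G.effectiveResistance x y ≤ ENNReal.ofReal c := by
  obtain ⟨p, hp⟩ : ∃ p, G.IsUnitPotential x y p := by
    refine exists_isUnitPotential fun f hf => ?_
    have := h f
    rw [hf, mul_zero] at this
    nlinarith [sq_nonneg (f x - f y)]
  rw [hp.effectiveResistance_eq_norm]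
  refine ENNReal.ofReal_le_ofReal ?_
  have h1 := h p
  rw [← hp.inner_grad, real_inner_self_eq_norm_sq, ← norm_grad_sq] at h1
  rcases (sq_nonneg ‖G.grad p‖).eq_or_lt with h0 | h0
  · rw [← h0]; exact hc
  · rw [pow_two (‖G.grad p‖ ^ 2)] at h1
    exact le_of_mul_le_mul_right h1 h0

theorem sq_sub_le_of_effectiveResistance_ne_top {G : Multigraph V} {x y : V}
    (h : G.effectiveResistance x y ≠ ∞) (f : V → ℝ) :
    (f x - f y) ^ 2 ≤ (G.effectiveResistance x y).toReal * G.energy f := by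
  obtain ⟨p, hp⟩ := exists_isUnitPotential_of_ne_top h
  rw [hp.effectiveResistance_eq_norm, ENNReal.toReal_ofReal (by positivity), ← hp.inner_grad,
    ← norm_grad_sq, ← mul_pow, mul_comm, sq_le_sq, abs_of_nonneg (by positivity : 0 ≤ ‖_‖ * ‖_‖)]
  exact abs_real_inner_le_norm _ _

/-- Rayleigh's monotonicity law, for a graph `G` mapped into a graph `H`. -/
theorem effectiveResistance_le_of_energy_le {G : Multigraph V} {H : Multigraph W} (φ : V → W)
    (h : ∀ f : W → ℝ, G.energy (f ∘ φ) ≤ H.energy f) (x y : V) :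
    H.effectiveResistance (φ x) (φ y) ≤ G.effectiveResistance x y := by
  by_cases ht : G.effectiveResistance x y = ∞
  · simp [ht]
  · rw [← ENNReal.ofReal_toReal ht]
    refine effectiveResistance_le ENNReal.toReal_nonneg fun f => ?_
    exact (sq_sub_le_of_effectiveResistance_ne_top ht (f ∘ φ)).trans
      (mul_le_mul_of_nonneg_left (h f) ENNReal.toReal_nonneg)

@[simp] theorem effectiveResistance_self (G : Multigraph V) (x : V) :
    G.effectiveResistance x x = 0 := by
  simpa using effectiveResistance_le (G := G) (x := x) (y := x) le_rfl (by simp)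

/-- The Hilbert space embedding of a connected network: vertices `x ↦ φ x` and functions
`f ↦ ∇ f` live in one Euclidean space, differences of `f` are inner products, and resistances are
squared distances. -/
theorem exists_embedding (G : Multigraph V) (o : V)
    (h : ∀ x, G.effectiveResistance o x ≠ ∞) :
    ∃ φ : V → EuclideanSpace ℝ (V × V),
      (∀ x y, G.effectiveResistance x y = ENNReal.ofReal (‖φ x - φ y‖ ^ 2)) ∧
      ∀ f x y, f x - f y = inner ℝ (G.grad f) (φ x - φ y) := by
  choose p hp using fun x => exists_isUnitPotential_of_ne_top (h x)
  have key : ∀ x y, G.IsUnitPotential x y (p y - p x) := by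
    intro x y u
    have h1 := hp x u
    have h2 := hp y u
    have : ∑ w, (G.mult u w : ℝ) * ((p y - p x) u - (p y - p x) w)
        = ∑ w, (G.mult u w : ℝ) * (p y u - p y w) - ∑ w, (G.mult u w : ℝ) * (p x u - p x w) := by
      rw [← Finset.sum_sub_distrib]
      exact Finset.sum_congr rfl fun w _ => by simp only [Pi.sub_apply]; ring
    rw [this, h1, h2]
    ring
  refine ⟨fun x => - G.grad (p x), fun x y => ?_, fun f x y => ?_⟩
  · rw [(key x y).effectiveResistance_eq_norm, map_sub, neg_sub_neg]
  · rw [← (key x y).inner_grad, map_sub, neg_sub_neg]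

end Resistance

end Multigraph

open Multigraph

/-! ### Subadditivity and the limit of `b_n` -/

/-- The least total resistance `∑_x R_{ρx}` of a rooted graph with `n` non-root vertices and at most
`αn/2` edges, which is `n * b_n(α)`. Unlike `b_n(α)` it is subadditive in `n`. -/
noncomputable def bTotal (n : ℕ) (α : ℝ) : ℝ≥0∞ :=
  ⨅ (G : Multigraph (Fin (n + 1))) (ρ : Fin (n + 1)) (_ : (G.edgeCount : ℝ) ≤ α * n / 2),
    ∑ x, G.effectiveResistance ρ x

theorem bSeq_eq (n : ℕ) (α : ℝ) (hn : n ≠ 0) : bSeq n α = bTotal n α / n := by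
  have h : ((n : ℝ≥0∞))⁻¹ ≠ 0 := by simp
  have h' : ((n : ℝ≥0∞))⁻¹ ≠ ∞ := by simpa using hn
  simp only [bSeq, bTotal, rootedAvgResistance, div_eq_mul_inv, ENNReal.iInf_mul_of_ne h h',
    Fintype.card_fin, Nat.cast_add, Nat.cast_one, ENNReal.add_sub_cancel_right ENNReal.one_ne_top]

section Rooted

variable {V W : Type*} [DecidableEq V] [Fintype V] [DecidableEq W] [Fintype W]

theorem bTotal_le {α : ℝ} {n : ℕ} (G : Multigraph (Option V)) (hV : Fintype.card V = n)
    (h : (G.edgeCount : ℝ) ≤ α * n / 2) :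
    bTotal n α ≤ ∑ x : V, G.effectiveResistance none (some x) := by
  let e : Option V ≃ Fin (n + 1) := Fintype.equivFinOfCardEq (by simp [hV])
  refine (iInf₂_le (G.map e.toEmbedding) (e none)).trans ?_
  refine (iInf_le _ (by simpa using h)).trans ?_
  rw [← e.sum_comp, Fintype.sum_option, effectiveResistance_self, zero_add]
  exact Finset.sum_le_sum fun x _ =>
    effectiveResistance_le_of_energy_le e (fun f => (energy_map G e.toEmbedding f).ge) _ _

theorem exists_option_graph {n : ℕ} (G : Multigraph (Fin (n + 1))) (ρ : Fin (n + 1)) :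
    ∃ H : Multigraph (Option (Fin n)), H.edgeCount = G.edgeCount ∧
      ∑ x, H.effectiveResistance none (some x) ≤ ∑ x, G.effectiveResistance ρ x := by
  let e : Fin (n + 1) ≃ Option (Fin n) := finSuccEquiv' ρ
  have he : e ρ = none := finSuccEquiv'_at ρ
  refine ⟨G.map e.toEmbedding, by simp, ?_⟩
  calc ∑ x, (G.map e.toEmbedding).effectiveResistance none (some x)
      = ∑ x, (G.map e.toEmbedding).effectiveResistance (e ρ) (e x) := by
        rw [e.sum_comp (fun x => (G.map e.toEmbedding).effectiveResistance (e ρ) x), he,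
          Fintype.sum_option, effectiveResistance_self, zero_add]
    _ ≤ _ := Finset.sum_le_sum fun x _ =>
        effectiveResistance_le_of_energy_le e (fun f => (energy_map G e.toEmbedding f).ge) _ _

/-- Gluing two rooted graphs at their roots. -/
def glue (G : Multigraph (Option V)) (H : Multigraph (Option W)) : Multigraph (Option (V ⊕ W)) :=
  (G.map (Function.Embedding.inl.optionMap)).union (H.map (Function.Embedding.inr.optionMap))

theorem bTotal_le_glue {α : ℝ} {n : ℕ} (G : Multigraph (Option V)) (H : Multigraph (Option W))
    (hn : Fintype.card V + Fintype.card W = n)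
    (h : (G.edgeCount : ℝ) + H.edgeCount ≤ α * n / 2) :
    bTotal n α ≤ ∑ x : V, G.effectiveResistance none (some x)
      + ∑ x : W, H.effectiveResistance none (some x) := by
  refine (bTotal_le (glue G H) (by simpa using hn) (by simpa [glue] using h)).trans ?_
  rw [Fintype.sum_sum_type]
  refine add_le_add (Finset.sum_le_sum fun x _ => ?_) (Finset.sum_le_sum fun x _ => ?_)
  · refine effectiveResistance_le_of_energy_le (Function.Embedding.inl.optionMap)
      (fun f => ?_) none (some x)
    simp only [glue, energy_union, energy_map]
    exact le_add_of_nonneg_right (energy_nonneg _ _)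
  · refine effectiveResistance_le_of_energy_le (Function.Embedding.inr.optionMap)
      (fun f => ?_) none (some x)
    simp only [glue, energy_union, energy_map]
    exact le_add_of_nonneg_left (energy_nonneg _ _)

theorem effectiveResistance_spokes_le (x : V) :
    (spokes (id : V → V)).effectiveResistance none (some x) ≤ 1 := by
  rw [← ENNReal.ofReal_one]
  refine effectiveResistance_le zero_le_one fun f => ?_
  rw [one_mul, energy_spokes]
  exact Finset.single_le_sum (f := fun j => (f none - f (some (id j))) ^ 2)
    (fun _ _ => sq_nonneg _) (Finset.mem_univ x)

/-- A surplus of `k` edges is paid for by `2k` additional vertices, each joined to the root by a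
single edge. -/
theorem bTotal_le_of_surplus {α : ℝ} (hα : 3 ≤ α) {n k : ℕ} (G : Multigraph (Option V))
    (hV : Fintype.card V = n) (h : (G.edgeCount : ℝ) ≤ α * n / 2 + k) :
    bTotal (n + 2 * k) α ≤ ∑ x : V, G.effectiveResistance none (some x) + 2 * k := by
  refine (bTotal_le_glue G (spokes (id : Fin (2 * k) → Fin (2 * k))) (by simp [hV]) ?_).trans ?_
  · simp only [edgeCount_spokes, Fintype.card_fin]
    push_cast
    have : (0 : ℝ) ≤ k := k.cast_nonneg
    nlinarith
  · gcongr
    refine (Finset.sum_le_sum fun x _ => effectiveResistance_spokes_le x).trans ?_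
    simp

end Rooted

theorem bTotal_add_le (m n : ℕ) (α : ℝ) : bTotal (m + n) α ≤ bTotal m α + bTotal n α := by
  conv_rhs => simp only [bTotal, ENNReal.iInf_add, ENNReal.add_iInf]
  refine le_iInf fun H => le_iInf fun σ => le_iInf fun hH =>
    le_iInf fun G => le_iInf fun ρ => le_iInf fun hG => ?_
  obtain ⟨G', hG', hR⟩ := exists_option_graph G ρ
  obtain ⟨H', hH', hR'⟩ := exists_option_graph H σ
  refine (bTotal_le_glue G' H' (by simp) ?_).trans (add_le_add hR hR')
  rw [hG', hH']
  push_cast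
  linarith

theorem bTotal_le_self {α : ℝ} (hα : 2 ≤ α) (n : ℕ) : bTotal n α ≤ n := by
  refine (bTotal_le (spokes (id : Fin n → Fin n)) (by simp) ?_).trans ?_
  · have : (0 : ℝ) ≤ n := n.cast_nonneg
    simp only [edgeCount_spokes, Fintype.card_fin]
    nlinarith
  · refine (Finset.sum_le_sum fun x _ => effectiveResistance_spokes_le x).trans ?_
    simp

/-- By Fekete's lemma `b_n(α)` converges to its infimum. -/
theorem exists_tendsto_bSeq {α : ℝ} (hα : 2 ≤ α) :
    ∃ β : ℝ, 0 ≤ β ∧ Tendsto (fun n => bSeq n α) atTop (𝓝 (ENNReal.ofReal β)) ∧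
      ∀ n : ℕ, n * ENNReal.ofReal β ≤ bTotal n α := by
  have htop : ∀ n, bTotal n α ≠ ∞ := fun n =>
    ne_top_of_le_ne_top (ENNReal.natCast_ne_top n) (bTotal_le_self hα n)
  have hsub : Subadditive fun n => (bTotal n α).toReal := fun m n => by
    rw [← ENNReal.toReal_add (htop m) (htop n)]
    exact ENNReal.toReal_mono (ENNReal.add_ne_top.2 ⟨htop m, htop n⟩) (bTotal_add_le m n α)
  have hbdd : BddBelow (Set.range fun n => (bTotal n α).toReal / (n : ℝ)) :=
    ⟨0, by rintro _ ⟨n, rfl⟩; positivity⟩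
  have hlim := hsub.tendsto_lim hbdd
  have h0 : 0 ≤ hsub.lim := ge_of_tendsto' hlim fun n => by positivity
  refine ⟨hsub.lim, h0, ?_, fun n => ?_⟩
  · refine ((ENNReal.continuous_ofReal.tendsto _).comp hlim).congr' ?_
    filter_upwards [eventually_ne_atTop 0] with n hn
    have hn' : (0 : ℝ) < n := by positivity
    rw [bSeq_eq n α hn, Function.comp_apply, ENNReal.ofReal_div_of_pos hn',
      ENNReal.ofReal_toReal (htop n), ENNReal.ofReal_natCast]
  · rcases eq_or_ne n 0 with rfl | hn
    · simp
    · have hn' : (0 : ℝ) < n := by positivity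
      have := hsub.lim_le_div hbdd hn
      rw [le_div_iff₀ hn'] at this
      rw [← ENNReal.ofReal_natCast, ← ENNReal.ofReal_mul n.cast_nonneg, mul_comm,
        ← ENNReal.ofReal_toReal (htop n)]
      exact ENNReal.ofReal_le_ofReal this

/-! ### Averages in Hilbert space -/

section Hilbert

variable {ι E : Type*} [Fintype ι] [NormedAddCommGroup E] [InnerProductSpace ℝ E]

theorem sum_norm_add_sq (v : ι → E) (u : E) :
    ∑ x, ‖u + v x‖ ^ 2
      = Fintype.card ι * ‖u‖ ^ 2 + 2 * inner ℝ u (∑ x, v x) + ∑ x, ‖v x‖ ^ 2 := by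
  simp only [norm_add_sq_real, Finset.sum_add_distrib, inner_sum, Finset.mul_sum]
  simp

theorem sum_sum_norm_sub_sq (v : ι → E) :
    ∑ x, ∑ y, ‖v x - v y‖ ^ 2 = 2 * Fintype.card ι * ∑ x, ‖v x‖ ^ 2 - 2 * ‖∑ x, v x‖ ^ 2 := by
  have h : ∀ x, ∑ y, ‖v x - v y‖ ^ 2
      = Fintype.card ι * ‖v x‖ ^ 2 - 2 * inner ℝ (v x) (∑ y, v y) + ∑ y, ‖v y‖ ^ 2 := by
    intro x
    have := sum_norm_add_sq (fun y => - v y) (v x)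
    simp only [← sub_eq_add_neg, norm_neg, Finset.sum_neg_distrib, inner_neg_right] at this
    rw [this]; ring
  simp only [h, Finset.sum_add_distrib, Finset.sum_sub_distrib, ← Finset.mul_sum, ← sum_inner,
    real_inner_self_eq_norm_sq]
  simp
  ring

/-- Among `k`-term sums from a centred family there is one whose squared norm is at most the mean
over independent uniform samples; the samples are chosen greedily. -/
theorem exists_norm_sum_sq_le [Nonempty ι] (v : ι → E) (hv : ∑ x, v x = 0) (k : ℕ) :
    ∃ s : Fin k → ι, Fintype.card ι * ‖∑ j, v (s j)‖ ^ 2 ≤ k * ∑ x, ‖v x‖ ^ 2 := by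
  induction k with
  | zero => exact ⟨Fin.elim0, by simp⟩
  | succ k ih =>
    obtain ⟨s, hs⟩ := ih
    set u := ∑ j, v (s j)
    obtain ⟨x, -, hx⟩ : ∃ x ∈ Finset.univ, (Fintype.card ι : ℝ) * ‖u + v x‖ ^ 2
        ≤ Fintype.card ι * ‖u‖ ^ 2 + ∑ x, ‖v x‖ ^ 2 := by
      refine Finset.exists_le_of_sum_le Finset.univ_nonempty ?_
      rw [← Finset.mul_sum, sum_norm_add_sq, hv]
      simp [mul_add]
    refine ⟨Fin.cons x s, ?_⟩
    rw [Fin.sum_univ_succ]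
    simp only [Fin.cons_zero, Fin.cons_succ]
    rw [add_comm (v x)]
    push_cast
    linarith

theorem add_sq_le_of_sq_le {a b A B X Y : ℝ} (hA : 0 ≤ A) (hB : 0 ≤ B) (hX : 0 ≤ X) (hY : 0 ≤ Y)
    (ha : a ^ 2 ≤ A * X) (hb : b ^ 2 ≤ B * Y) : (a + b) ^ 2 ≤ (A + B) * (X + Y) := by
  have h1 : (a * b) ^ 2 ≤ ((A * Y + B * X) / 2) ^ 2 := by
    have : (a * b) ^ 2 ≤ (A * X) * (B * Y) := by
      rw [mul_pow]; exact mul_le_mul ha hb (sq_nonneg b) (mul_nonneg hA hX)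
    nlinarith [sq_nonneg (A * Y - B * X)]
  have h2 := abs_le_of_sq_le_sq h1 (by positivity)
  nlinarith [le_abs_self (a * b)]

end Hilbert

/-! ### Average resistance is at most twice the rooted average resistance -/

section UpperBound

/-- Averaging over pairs costs at most a factor `2` over resistances to a root, since the mean
squared distance in a Hilbert space is at most twice the mean squared distance from any point. -/
theorem avgResistance_le {n : ℕ} (hn : n ≠ 0) (G : Multigraph (Fin (n + 1))) (ρ : Fin (n + 1)) :
    G.avgResistance ≤ 2 * G.rootedAvgResistance ρ := by
  have hcast : ((Fintype.card (Fin (n + 1)) : ℕ) : ℝ≥0∞) - 1 = n := by simp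
  have hn0 : (n : ℝ≥0∞) ≠ 0 := by simpa using hn
  rw [rootedAvgResistance, hcast]
  by_cases ht : ∑ x, G.effectiveResistance ρ x = ∞
  · rw [ht, ENNReal.top_div_of_ne_top (ENNReal.natCast_ne_top n)]
    simp
  obtain ⟨φ, hφ, -⟩ := exists_embedding G ρ fun x => ENNReal.sum_ne_top.1 ht x (Finset.mem_univ x)
  have hsum : ∑ x, ∑ y, G.effectiveResistance x y
      ≤ 2 * (n + 1) * ∑ x, G.effectiveResistance ρ x := by
    have h1 : ∑ x, ∑ y, G.effectiveResistance x y
        = ENNReal.ofReal (∑ x, ∑ y, ‖φ x - φ y‖ ^ 2) := by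
      simp only [hφ]
      rw [ENNReal.ofReal_sum_of_nonneg fun x _ => by positivity]
      exact Finset.sum_congr rfl fun x _ =>
        (ENNReal.ofReal_sum_of_nonneg fun y _ => by positivity).symm
    have h2 : 2 * ((n : ℝ≥0∞) + 1) * ∑ x, G.effectiveResistance ρ x
        = ENNReal.ofReal (2 * (n + 1) * ∑ x, ‖φ ρ - φ x‖ ^ 2) := by
      rw [ENNReal.ofReal_mul (by positivity), ENNReal.ofReal_sum_of_nonneg fun x _ => by positivity,
        ENNReal.ofReal_mul (by positivity), ENNReal.ofReal_add (by positivity) zero_le_one]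
      simp [hφ]
    rw [h1, h2]
    refine ENNReal.ofReal_le_ofReal ?_
    have h3 := sum_sum_norm_sub_sq fun x => φ ρ - φ x
    simp only [sub_sub_sub_cancel_left, Fintype.card_fin] at h3
    have h4 : ∑ x, ∑ y, ‖φ x - φ y‖ ^ 2 = ∑ x, ∑ y, ‖φ y - φ x‖ ^ 2 :=
      Finset.sum_congr rfl fun x _ => Finset.sum_congr rfl fun y _ => by rw [norm_sub_rev]
    rw [h4, h3]
    push_cast
    linarith [sq_nonneg ‖∑ x, (φ ρ - φ x)‖]
  refine ENNReal.div_le_of_le_mul (hsum.trans ?_)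
  have hS : ∑ x, G.effectiveResistance ρ x = (∑ x, G.effectiveResistance ρ x) / n * n :=
    (ENNReal.div_mul_cancel hn0 (ENNReal.natCast_ne_top n)).symm
  set T := (∑ x, G.effectiveResistance ρ x) / n
  rw [hS, Fintype.card_fin]
  push_cast
  calc 2 * ((n : ℝ≥0∞) + 1) * (T * n) ≤ 2 * ((n : ℝ≥0∞) + 1) * (T * (n + 1)) := by
        gcongr; exact le_self_add
    _ = 2 * T * (n + 1) ^ 2 := by ring

theorem aSeq_succ_le {α : ℝ} (hα : 0 ≤ α) {n : ℕ} (hn : n ≠ 0) :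
    aSeq (n + 1) α ≤ 2 * bSeq n α := by
  simp only [bSeq, ENNReal.mul_iInf_of_ne two_ne_zero ENNReal.ofNat_ne_top]
  refine le_iInf fun G => le_iInf fun ρ => le_iInf fun hG => ?_
  refine (iInf₂_le G ?_).trans (avgResistance_le hn G ρ)
  push_cast
  linarith

end UpperBound

/-! ### Rooting a graph at a random sample of vertices -/

section LowerBound

variable {V : Type*} [DecidableEq V] [Fintype V]

/-- The graph `G` with an additional root, joined by one edge to each of the sampled vertices
`s j`. -/
def addRoot (G : Multigraph V) {k : ℕ} (s : Fin k → V) : Multigraph (Option V) :=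
  (G.map Function.Embedding.some).union (spokes s)

/-- A unit current from `x` to the new root may leave `G` in equal parts through the `k` sampled
vertices; `φ` is the embedding of `exists_embedding`. -/
theorem effectiveResistance_addRoot_le {E : Type*} [NormedAddCommGroup E] [InnerProductSpace ℝ E]
    (G : Multigraph V) {k : ℕ} (hk : k ≠ 0)
    (s : Fin k → V) (φ : V → E) (D : (V → ℝ) → E) (hD : ∀ f, ‖D f‖ ^ 2 = G.energy f)
    (hφ : ∀ f x y, f x - f y = inner ℝ (D f) (φ x - φ y)) (x : V) :
    (addRoot G s).effectiveResistance none (some x)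
      ≤ ENNReal.ofReal (‖φ x - (k : ℝ)⁻¹ • ∑ j, φ (s j)‖ ^ 2 + (k : ℝ)⁻¹) := by
  have hk' : (0 : ℝ) < k := by positivity
  refine effectiveResistance_le (by positivity) fun f => ?_
  set g : V → ℝ := f ∘ some
  have hE : (addRoot G s).energy f = G.energy g + ∑ j, (f none - g (s j)) ^ 2 := by
    simp only [addRoot, energy_union, energy_map, energy_spokes]
    rfl
  have h1 : inner ℝ (D g) (φ x - (k : ℝ)⁻¹ • ∑ j, φ (s j)) = g x - (k : ℝ)⁻¹ * ∑ j, g (s j) := by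
    have : φ x - (k : ℝ)⁻¹ • ∑ j, φ (s j) = (k : ℝ)⁻¹ • ∑ j, (φ x - φ (s j)) := by
      rw [Finset.sum_sub_distrib, smul_sub]
      simp only [Finset.sum_const, Finset.card_univ, Fintype.card_fin]
      rw [← Nat.cast_smul_eq_nsmul ℝ, smul_smul, inv_mul_cancel₀ hk'.ne', one_smul]
    rw [this, inner_smul_right, inner_sum]
    simp only [← hφ, Finset.sum_sub_distrib, Finset.sum_const, Finset.card_univ, Fintype.card_fin,
      nsmul_eq_mul]
    field_simp
  have h2 : f none - f (some x)
      = -inner ℝ (D g) (φ x - (k : ℝ)⁻¹ • ∑ j, φ (s j)) + (k : ℝ)⁻¹ * ∑ j, (f none - g (s j)) := by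
    rw [h1]
    simp only [Finset.sum_sub_distrib, Finset.sum_const, Finset.card_univ, Fintype.card_fin,
      nsmul_eq_mul]
    have : f (some x) = g x := rfl
    rw [this]
    field_simp
    ring
  rw [h2, hE]
  refine add_sq_le_of_sq_le (by positivity) (by positivity) (energy_nonneg _ _)
    (Finset.sum_nonneg fun _ _ => sq_nonneg _) ?_ ?_
  · rw [neg_sq, ← hD, mul_comm, ← mul_pow, sq_le_sq, abs_of_nonneg (by positivity : 0 ≤ ‖_‖ * ‖_‖)]
    exact abs_real_inner_le_norm _ _
  · have := sq_sum_le_card_mul_sum_sq (s := Finset.univ) (f := fun j => f none - g (s j))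
    rw [Finset.card_univ, Fintype.card_fin] at this
    rw [mul_pow, pow_two (k : ℝ)⁻¹, mul_assoc]
    refine mul_le_mul_of_nonneg_left ?_ (by positivity)
    rw [inv_mul_le_iff₀ hk']
    exact this

/-- Up to lower order terms, half the average resistance of any graph is at least `b(α)`: a graph
with `n` vertices becomes a rooted graph by joining `k` well chosen vertices to a new root. -/
theorem bTotal_le_of_avgResistance {α : ℝ} (hα : 3 ≤ α) {n k : ℕ} (hn : n ≠ 0) (hk : k ≠ 0)
    (G : Multigraph (Fin n)) (hG : (G.edgeCount : ℝ) ≤ α * n / 2) (ht : G.avgResistance ≠ ∞) :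
    bTotal (n + 2 * k) α ≤ ENNReal.ofReal
      (n * ((1 + (k : ℝ)⁻¹) * (G.avgResistance.toReal / 2) + (k : ℝ)⁻¹) + 2 * k) := by
  have hk' : (0 : ℝ) < k := by positivity
  have hn' : (0 : ℝ) < n := by positivity
  have : Nonempty (Fin n) := ⟨⟨0, Nat.pos_of_ne_zero hn⟩⟩
  have hne : ∀ x y, G.effectiveResistance x y ≠ ∞ := by
    have hs : ∑ x, ∑ y, G.effectiveResistance x y ≠ ∞ := fun h => ht <| by
      rw [avgResistance, h, ENNReal.top_div_of_ne_top]
      simp [Fintype.card_fin]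
    exact fun x y => ENNReal.sum_ne_top.1 (ENNReal.sum_ne_top.1 hs x (Finset.mem_univ x)) y
      (Finset.mem_univ y)
  obtain ⟨φ, hR, hφ⟩ := exists_embedding G ⟨0, Nat.pos_of_ne_zero hn⟩ (hne _)
  set v : Fin n → EuclideanSpace ℝ (Fin n × Fin n) := fun x => φ x - (n : ℝ)⁻¹ • ∑ y, φ y with hv
  have hsum : ∑ x, v x = 0 := by
    simp only [hv, Finset.sum_sub_distrib, Finset.sum_const, Finset.card_univ, Fintype.card_fin]
    rw [← Nat.cast_smul_eq_nsmul ℝ, smul_smul, mul_inv_cancel₀ hn'.ne', one_smul, sub_self]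
  have hA : G.avgResistance.toReal = 2 * (n : ℝ)⁻¹ * ∑ x, ‖v x‖ ^ 2 := by
    have h1 : ∑ x, ∑ y, ‖φ x - φ y‖ ^ 2
        = 2 * Fintype.card (Fin n) * ∑ x, ‖v x‖ ^ 2 - 2 * ‖∑ x, v x‖ ^ 2 := by
      rw [← sum_sum_norm_sub_sq]
      simp only [hv, sub_sub_sub_cancel_right]
    have h2 : ∑ x, ∑ y, ‖φ x - φ y‖ ^ 2 = (∑ x, ∑ y, G.effectiveResistance x y).toReal := by
      rw [ENNReal.toReal_sum fun x _ => ENNReal.sum_ne_top.2 fun y _ => hne x y]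
      refine Finset.sum_congr rfl fun x _ => ?_
      rw [ENNReal.toReal_sum fun y _ => hne x y]
      exact Finset.sum_congr rfl fun y _ => by
        rw [hR, ENNReal.toReal_ofReal (by positivity)]
    rw [avgResistance, ENNReal.toReal_div, ← h2, h1]
    rw [hsum]
    simp only [Fintype.card_fin, ENNReal.toReal_pow, ENNReal.toReal_natCast, norm_zero]
    field_simp
    ring
  obtain ⟨s, hs⟩ := exists_norm_sum_sq_le v hsum k
  rw [Fintype.card_fin] at hs
  refine (bTotal_le_of_surplus hα (addRoot G s) (Fintype.card_fin n) (k := k) ?_).trans ?_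
  · simpa [addRoot] using hG
  have hbound := Finset.sum_le_sum (s := Finset.univ) fun x _ =>
    effectiveResistance_addRoot_le G hk s φ G.grad (norm_grad_sq G) hφ x
  refine (add_le_add_left hbound _).trans ?_
  rw [← ENNReal.ofReal_sum_of_nonneg fun x _ => by positivity]
  have h2k : (2 : ℝ≥0∞) * k = ENNReal.ofReal (2 * k) := by
    rw [ENNReal.ofReal_mul zero_le_two]; simp
  rw [h2k, ← ENNReal.ofReal_add (Finset.sum_nonneg fun x _ => by positivity) (by positivity)]
  refine ENNReal.ofReal_le_ofReal ?_
  rw [Finset.sum_add_distrib]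
  have h3 : ∀ x, φ x - (k : ℝ)⁻¹ • ∑ j, φ (s j) = -((k : ℝ)⁻¹ • ∑ j, v (s j)) + v x := by
    intro x
    simp only [hv, Finset.sum_sub_distrib, Finset.sum_const, Finset.card_univ, Fintype.card_fin]
    rw [← Nat.cast_smul_eq_nsmul ℝ, smul_sub, smul_smul, inv_mul_cancel₀ hk'.ne', one_smul]
    abel
  simp only [h3]
  rw [sum_norm_add_sq, hsum, hA, norm_neg, norm_smul, mul_pow]
  simp only [inner_zero_right, Fintype.card_fin, Finset.sum_const, Finset.card_univ, nsmul_eq_mul,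
    norm_inv, Real.norm_natCast]
  have h4 : (n : ℝ) * (((k : ℝ)⁻¹) ^ 2 * ‖∑ j, v (s j)‖ ^ 2) ≤ (k : ℝ)⁻¹ * ∑ x, ‖v x‖ ^ 2 := by
    have := mul_le_mul_of_nonneg_left hs (by positivity : (0 : ℝ) ≤ ((k : ℝ)⁻¹) ^ 2)
    calc _ = (k : ℝ)⁻¹ ^ 2 * (n * ‖∑ j, v (s j)‖ ^ 2) := by ring
      _ ≤ _ := this
      _ = _ := by field_simp
  have h5 : (n : ℝ) * ((1 + (k : ℝ)⁻¹) * (2 * (n : ℝ)⁻¹ * (∑ x, ‖v x‖ ^ 2) / 2) + (k : ℝ)⁻¹)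
      = (1 + (k : ℝ)⁻¹) * (∑ x, ‖v x‖ ^ 2) + n * (k : ℝ)⁻¹ := by
    field_simp
  rw [h5]
  linarith

end LowerBound

/-! ### The limit of `a_n` -/

/-- `a(α) = 2 b(α)`, where `β = b(α)`. -/
theorem tendsto_aSeq {α : ℝ} (hα : 3 ≤ α) {β : ℝ} (hβ : 0 ≤ β)
    (hlim : Tendsto (fun n => bSeq n α) atTop (𝓝 (ENNReal.ofReal β)))
    (hle : ∀ n : ℕ, n * ENNReal.ofReal β ≤ bTotal n α) :
    Tendsto (fun n => aSeq n α) atTop (𝓝 (ENNReal.ofReal (2 * β))) := by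
  refine (tendsto_add_atTop_iff_nat 1).1 ?_
  have hup : Tendsto (fun n => 2 * bSeq n α) atTop (𝓝 (ENNReal.ofReal (2 * β))) := by
    have := ENNReal.Tendsto.const_mul (a := 2) hlim (Or.inr ENNReal.ofNat_ne_top)
    rwa [ENNReal.ofReal_mul zero_le_two, ENNReal.ofReal_ofNat]
  -- The number of sampled vertices is the square root of the number of vertices.
  have hlow : Tendsto (fun n : ℕ => ENNReal.ofReal
      (2 * (β - 3 * ((Nat.sqrt (n + 1) : ℕ) : ℝ)⁻¹) / (1 + ((Nat.sqrt (n + 1) : ℕ) : ℝ)⁻¹)))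
      atTop (𝓝 (ENNReal.ofReal (2 * β))) := by
    have hs : Tendsto (fun n : ℕ => Nat.sqrt (n + 1)) atTop atTop := by
      refine tendsto_atTop.2 fun m => ?_
      filter_upwards [eventually_ge_atTop (m * m)] with n hn
      exact Nat.le_sqrt.2 (hn.trans n.le_succ)
    have hi : Tendsto (fun k : ℕ => (k : ℝ)⁻¹) atTop (𝓝 0) := tendsto_inv_atTop_nhds_zero_nat
    have h1 : Tendsto (fun k : ℕ => 2 * (β - 3 * (k : ℝ)⁻¹) / (1 + (k : ℝ)⁻¹)) atTop
        (𝓝 (2 * (β - 3 * 0) / (1 + 0))) :=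
      ((hi.const_mul 3).const_sub β |>.const_mul 2).div (hi.const_add 1) (by norm_num)
    rw [mul_zero, sub_zero, add_zero, div_one] at h1
    exact ((ENNReal.continuous_ofReal.tendsto _).comp h1).comp hs
  refine tendsto_of_tendsto_of_tendsto_of_le_of_le' hlow hup
    (Eventually.of_forall fun n => ?_) ?_
  · obtain ⟨N, hN⟩ : ∃ N, N = n + 1 := ⟨_, rfl⟩
    rw [← hN]
    refine le_iInf₂ fun G hG => ?_
    by_cases ht : G.avgResistance = ∞
    · simp [ht]
    set k := Nat.sqrt N with hk
    have hN0 : N ≠ 0 := by omega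
    have hk0 : k ≠ 0 := (Nat.sqrt_pos.2 (by omega)).ne'
    have hN' : (0 : ℝ) < N := by positivity
    have hk' : (0 : ℝ) < k := by positivity
    have h1 := (hle (N + 2 * k)).trans (bTotal_le_of_avgResistance hα hN0 hk0 G hG ht)
    rw [← ENNReal.ofReal_natCast, ← ENNReal.ofReal_mul (Nat.cast_nonneg _),
      ENNReal.ofReal_le_ofReal_iff (by positivity)] at h1
    rw [← ENNReal.ofReal_toReal ht]
    refine ENNReal.ofReal_le_ofReal ?_
    set A := G.avgResistance.toReal
    have hkN : (k : ℝ) ≤ N * (k : ℝ)⁻¹ := by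
      rw [← div_eq_mul_inv, le_div_iff₀ hk']
      exact_mod_cast Nat.sqrt_le N
    rw [div_le_iff₀ (by positivity)]
    push_cast at h1
    have h2 : (N : ℝ) * β ≤ N * ((1 + (k : ℝ)⁻¹) * (A / 2) + 3 * (k : ℝ)⁻¹) := by
      have : 0 ≤ 2 * (k : ℝ) * β := by positivity
      nlinarith
    have h3 := le_of_mul_le_mul_left h2 hN'
    linarith
  · filter_upwards [eventually_ne_atTop 0] with n hn
    exact aSeq_succ_le (by linarith) hn

/-! ### Reduced words and balls of the regular tree -/

section Words

/-- The reduced words of length `k` over `d` letters, those without two equal adjacent letters. They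
are the vertices at distance `k` from the root `[]` of the `d`-regular tree. -/
def wordSphere (d : ℕ) : ℕ → Finset (List (Fin d))
  | 0 => {[]}
  | k + 1 => ((wordSphere d k ×ˢ Finset.univ).filter fun p => p.1.head? ≠ some p.2).image
      fun p => p.2 :: p.1

variable {d : ℕ}

theorem cons_mem_wordSphere {k : ℕ} {i : Fin d} {w : List (Fin d)} :
    i :: w ∈ wordSphere d (k + 1) ↔ w ∈ wordSphere d k ∧ w.head? ≠ some i := by
  simp [wordSphere]

theorem length_of_mem_wordSphere {k : ℕ} {w : List (Fin d)} (h : w ∈ wordSphere d k) :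
    w.length = k := by
  induction k generalizing w with
  | zero => simp_all [wordSphere]
  | succ k ih =>
    cases w with
    | nil => simp [wordSphere] at h
    | cons i w => simp [ih (cons_mem_wordSphere.1 h).1]

theorem sum_wordSphere_succ (k : ℕ) (F : List (Fin d) → ℝ) :
    ∑ w ∈ wordSphere d (k + 1), F w
      = ∑ w ∈ wordSphere d k, ∑ i with w.head? ≠ some i, F (i :: w) := by
  rw [wordSphere, Finset.sum_image, Finset.sum_filter, Finset.sum_product]
  · simp only [Finset.sum_filter]
  · rintro ⟨w, i⟩ - ⟨w', i'⟩ - h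
    simp_all

/-- The number of children in the `d`-regular tree of a vertex at distance `k` from the root. -/
def numChildren (d k : ℕ) : ℕ := if k = 0 then d else d - 1

theorem card_filter_head {k : ℕ} {w : List (Fin d)} (hw : w ∈ wordSphere d k) :
    (Finset.univ.filter fun i => w.head? ≠ some i).card = numChildren d k := by
  have hl := length_of_mem_wordSphere hw
  cases w with
  | nil => simp [numChildren, ← hl]
  | cons j w =>
    have : (Finset.univ.filter fun i => (j :: w).head? ≠ some i) = {j}ᶜ := by
      ext i; simp [eq_comm]
    rw [this, Finset.card_compl]
    simp [numChildren, ← hl]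

theorem sum_wordSphere_tail (k : ℕ) (F : List (Fin d) → ℝ) :
    ∑ w ∈ wordSphere d (k + 1), F w.tail = numChildren d k * ∑ w ∈ wordSphere d k, F w := by
  rw [sum_wordSphere_succ k fun w => F w.tail, Finset.mul_sum]
  refine Finset.sum_congr rfl fun w hw => ?_
  simp only [List.tail_cons, Finset.sum_const, nsmul_eq_mul]
  rw [card_filter_head hw]

theorem card_wordSphere_succ (k : ℕ) :
    (wordSphere d (k + 1)).card = d * (d - 1) ^ k := by
  have h : ∀ k, (wordSphere d (k + 1)).card = numChildren d k * (wordSphere d k).card := by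
    intro k
    have := sum_wordSphere_tail (d := d) k fun _ => 1
    simp only [Finset.sum_const, nsmul_eq_mul, mul_one] at this
    exact_mod_cast this
  induction k with
  | zero => rw [h]; simp [numChildren, wordSphere]
  | succ k ih => rw [h, ih]; simp [numChildren]; ring

theorem lt_card_wordSphere (hd : 3 ≤ d) (k : ℕ) : k < (wordSphere d k).card := by
  cases k with
  | zero => simp [wordSphere]
  | succ k =>
    rw [card_wordSphere_succ]
    have h1 : k < (d - 1) ^ k :=
      k.lt_two_pow_self.trans_le (Nat.pow_le_pow_left (by omega) k)
    nlinarith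

/-- The resistance from the root of the `d`-regular tree to the sphere of radius `r` is at most that
from the root to infinity. -/
theorem sum_inv_card_wordSphere_le (hd : 3 ≤ d) (r : ℕ) :
    ∑ k ∈ Finset.range r, ((wordSphere d (k + 1)).card : ℝ)⁻¹
      ≤ ((d : ℝ) - 1) / (d * (d - 2)) := by
  have hd' : (3 : ℝ) ≤ d := by exact_mod_cast hd
  have hd1 : (0 : ℝ) < (d : ℝ) - 1 := by linarith
  have hd2 : (0 : ℝ) < (d : ℝ) - 2 := by linarith
  have key : ∑ k ∈ Finset.range r, ((wordSphere d (k + 1)).card : ℝ)⁻¹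
      = ((d : ℝ) - 1) / (d * (d - 2)) * (1 - ((d : ℝ) - 1)⁻¹ ^ r) := by
    induction r with
    | zero => simp
    | succ r ih =>
      rw [Finset.sum_range_succ, ih, card_wordSphere_succ]
      push_cast [Nat.cast_sub (by omega : 1 ≤ d)]
      rw [mul_inv, ← inv_pow, pow_succ]
      field_simp
      ring
  rw [key]
  refine mul_le_of_le_one_right (by positivity) ?_
  have : 0 ≤ ((d : ℝ) - 1)⁻¹ ^ r := by positivity
  linarith

/-- The reduced words of length at most `R`: the ball of radius `R` in the `d`-regular tree. -/
def wordBall (d R : ℕ) : Finset (List (Fin d)) := (Finset.range (R + 1)).biUnion (wordSphere d)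

theorem mem_wordBall {R : ℕ} {w : List (Fin d)} :
    w ∈ wordBall d R ↔ w ∈ wordSphere d w.length ∧ w.length ≤ R := by
  simp only [wordBall, Finset.mem_biUnion, Finset.mem_range, Nat.lt_succ_iff]
  constructor
  · rintro ⟨k, hk, hw⟩
    have := length_of_mem_wordSphere hw
    exact ⟨this ▸ hw, this ▸ hk⟩
  · rintro ⟨hw, hk⟩
    exact ⟨_, hk, hw⟩

theorem wordSphere_subset_wordBall {k R : ℕ} (h : k ≤ R) : wordSphere d k ⊆ wordBall d R :=
  fun w hw => Finset.mem_biUnion.2 ⟨k, Finset.mem_range.2 (by omega), hw⟩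

theorem nil_mem_wordBall (R : ℕ) : ([] : List (Fin d)) ∈ wordBall d R :=
  mem_wordBall.2 ⟨by simp [wordSphere], by simp⟩

theorem cons_mem_wordBall {R : ℕ} {i : Fin d} {w : List (Fin d)} :
    i :: w ∈ wordBall d R ↔ w ∈ wordBall d R ∧ w.head? ≠ some i ∧ w.length < R := by
  rw [mem_wordBall, mem_wordBall, List.length_cons, cons_mem_wordSphere]
  constructor
  · rintro ⟨⟨h1, h2⟩, h3⟩
    exact ⟨⟨h1, by omega⟩, h2, by omega⟩
  · rintro ⟨⟨h1, -⟩, h2, h3⟩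
    exact ⟨⟨h1, h2⟩, by omega⟩

/-- The edges of the `d`-regular tree are properly coloured by the letters; this moves a vertex of
the ball of radius `R` along its edge of colour `i`, unless that leaves the ball. -/
def letterMove (R : ℕ) (i : Fin d) (w : wordBall d R) : wordBall d R :=
  if h : w.1.head? = some i then
    ⟨w.1.tail, by
      obtain ⟨w, hw⟩ := w
      cases w with
      | nil => simp at h
      | cons j w => exact (cons_mem_wordBall.1 hw).1⟩
  else if h' : w.1.length < R then ⟨i :: w.1, cons_mem_wordBall.2 ⟨w.2, h, h'⟩⟩
  else w

theorem letterMove_of_cons {R : ℕ} {i : Fin d} {w : List (Fin d)} (h : i :: w ∈ wordBall d R) :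
    letterMove R i ⟨i :: w, h⟩ = ⟨w, (cons_mem_wordBall.1 h).1⟩ := by
  simp [letterMove]

theorem letterMove_to_cons {R : ℕ} {i : Fin d} {w : List (Fin d)} (h : i :: w ∈ wordBall d R) :
    letterMove R i ⟨w, (cons_mem_wordBall.1 h).1⟩ = ⟨i :: w, h⟩ := by
  obtain ⟨-, h2, h3⟩ := cons_mem_wordBall.1 h
  simp [letterMove, h2, h3]

theorem letterMove_involutive (R : ℕ) (i : Fin d) : Function.Involutive (letterMove R i) := by
  rintro ⟨w, hw⟩
  by_cases h : w.head? = some i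
  · cases w with
    | nil => simp at h
    | cons j w =>
      obtain rfl : j = i := by simpa using h
      rw [letterMove_of_cons hw, letterMove_to_cons hw]
  · by_cases h' : w.length < R
    · have hc : i :: w ∈ wordBall d R := cons_mem_wordBall.2 ⟨hw, h, h'⟩
      rw [letterMove_to_cons hc, letterMove_of_cons hc]
    · have : letterMove R i ⟨w, hw⟩ = ⟨w, hw⟩ := by simp [letterMove, h, h']
      rw [this, this]

end Words

/-! ### Graphs of involutions with a root -/

section Coloured

variable {d : ℕ} {V : Type*} [DecidableEq V] [Fintype V]

/-- The edges `{v, s i v}` for a family of involutions `s i`. -/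
def involutionEdges (s : Fin d → V → V) : Finset (Sym2 V) :=
  Finset.univ.image fun p : Fin d × V => s(p.2, s p.1 p.2)

theorem not_isDiag_of_mem_involutionEdges {s : Fin d → V → V} (hne : ∀ i v, s i v ≠ v)
    (e : Sym2 V) (he : e ∈ involutionEdges s) : ¬ e.IsDiag := by
  obtain ⟨⟨i, v⟩, -, rfl⟩ := Finset.mem_image.1 he
  simpa using (hne i v).symm

theorem mem_involutionEdges (s : Fin d → V → V) (i : Fin d) (v : V) :
    s(v, s i v) ∈ involutionEdges s := Finset.mem_image.2 ⟨(i, v), Finset.mem_univ _, rfl⟩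

/-- The graph with edges `{v, s i v}` for involutions `s i` without fixed points. It is `d`-regular
if the points `s i v` are distinct for each `v`. -/
def involutionGraph (s : Fin d → V → V) (hne : ∀ i v, s i v ≠ v) : Multigraph V :=
  ofFinset (involutionEdges s) (not_isDiag_of_mem_involutionEdges hne)

theorem two_mul_edgeCount_involutionGraph_le {s : Fin d → V → V}
    (hs : ∀ i, Function.Involutive (s i)) (hne : ∀ i v, s i v ≠ v) :
    2 * (involutionGraph s hne).edgeCount ≤ d * Fintype.card V := by
  have := Finset.mul_card_image_le_card (s := (Finset.univ : Finset (Fin d × V)))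
    (f := fun p => s(p.2, s p.1 p.2)) (n := 2) fun e he => by
      obtain ⟨⟨i, v⟩, -, rfl⟩ := Finset.mem_image.1 he
      refine Finset.one_lt_card.2 ⟨(i, v), by simp, (i, s i v), ?_, ?_⟩
      · simp [hs i v]
      · simpa using (hne i v).symm
  simpa [involutionGraph, edgeCount_ofFinset, involutionEdges] using this

theorem sum_sq_sub_le_energy {s : Fin d → V → V} (hne : ∀ i v, s i v ≠ v) (i : Fin d)
    (f : V → ℝ) : ∑ v, (f v - f (s i v)) ^ 2 ≤ 2 * (involutionGraph s hne).energy f := by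
  rw [energy, ← sum_count_mul_sqDiff]
  refine Finset.sum_le_sum fun v _ => ?_
  have h1 : 1 ≤ (involutionGraph s hne).edges.count s(v, s i v) :=
    Multiset.one_le_count_iff_mem.2 (mem_involutionEdges s i v)
  refine le_trans ?_ (Finset.single_le_sum (f := fun w =>
    ((involutionGraph s hne).edges.count s(v, w) : ℝ) * (f v - f w) ^ 2)
    (fun w _ => by positivity) (Finset.mem_univ (s i v)))
  exact le_mul_of_one_le_left (sq_nonneg _) (by exact_mod_cast h1)

/-- The action of a word on the vertices, the last letter first. -/
def wordAct (s : Fin d → V → V) (w : List (Fin d)) (v : V) : V := w.foldr s v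

/-- If the `d`-regular tree is embedded up to radius `r` around `v`, then the uniform flow from `v`
to the sphere of radius `r` shows that the resistance from `v` to the uniform distribution on that
sphere is at most the resistance from the root to infinity in the infinite tree. In terms of
functions, the difference of the averages of `f` over two consecutive spheres is an average of
differences across edges, and the Cauchy-Schwarz inequality applies. -/
theorem sq_sub_sphere_average_le (hd : 3 ≤ d) {s : Fin d → V → V} (hne : ∀ i v, s i v ≠ v)
    {r : ℕ} {v : V}
    (hinj : Set.InjOn (fun w => wordAct s w v) (wordBall d r : Set (List (Fin d)))) (f : V → ℝ) :
    (f v - (∑ w ∈ wordSphere d r, f (wordAct s w v)) / (wordSphere d r).card) ^ 2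
      ≤ ((d : ℝ) - 1) / (d * (d - 2)) * (involutionGraph s hne).energy f := by
  set A : ℕ → ℝ := fun k => (∑ w ∈ wordSphere d k, f (wordAct s w v)) / (wordSphere d k).card
  set δ : List (Fin d) → ℝ := fun w => f (wordAct s w.tail v) - f (wordAct s w v) with hδ
  set D : ℕ → ℝ := fun k => ∑ w ∈ wordSphere d (k + 1), δ w ^ 2
  have hM : ∀ k, (0 : ℝ) < (wordSphere d k).card := fun k => by
    exact_mod_cast (Nat.zero_le k).trans_lt (lt_card_wordSphere hd k)
  have hD0 : ∀ k, 0 ≤ D k := fun k => Finset.sum_nonneg fun _ _ => sq_nonneg _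
  have hstep : ∀ k, (A k - A (k + 1)) ^ 2 ≤ ((wordSphere d (k + 1)).card : ℝ)⁻¹ * D k := by
    intro k
    have h1 := sum_wordSphere_tail (d := d) k fun w => f (wordAct s w v)
    have h2 := sum_wordSphere_tail (d := d) k fun _ => 1
    simp only [Finset.sum_const, nsmul_eq_mul, mul_one] at h2
    have h3 : A k - A (k + 1)
        = ((wordSphere d (k + 1)).card : ℝ)⁻¹ * ∑ w ∈ wordSphere d (k + 1), δ w := by
      simp only [A, hδ, Finset.sum_sub_distrib]
      rw [h1]
      have hM1 := hM (k + 1)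
      have hM0 := hM k
      have hc : (numChildren d k : ℝ) ≠ 0 := by
        intro h0
        rw [h0, zero_mul] at h2
        exact hM1.ne' h2
      rw [h2]
      field_simp
    have h4 := sq_sum_le_card_mul_sum_sq (s := wordSphere d (k + 1)) (f := δ)
    rw [h3, mul_pow, pow_two (_⁻¹ : ℝ), mul_assoc]
    refine mul_le_mul_of_nonneg_left ?_ (by positivity)
    rwa [inv_mul_le_iff₀ (hM _)]
  have htel : ∀ n, (A 0 - A n) ^ 2 ≤ (∑ k ∈ Finset.range n, ((wordSphere d (k + 1)).card : ℝ)⁻¹)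
      * ∑ k ∈ Finset.range n, D k := by
    intro n
    induction n with
    | zero => simp
    | succ n ih =>
      rw [Finset.sum_range_succ, Finset.sum_range_succ, ← sub_add_sub_cancel (A 0) (A n)]
      exact add_sq_le_of_sq_le (Finset.sum_nonneg fun _ _ => by positivity) (by positivity)
        (Finset.sum_nonneg fun k _ => hD0 k) (hD0 n) ih (hstep n)
  have hA0 : A 0 = f v := by simp [A, wordSphere, wordAct]
  -- Distinct words give distinct edges of the graph.
  have hDE : ∑ k ∈ Finset.range r, D k ≤ (involutionGraph s hne).energy f := by
    have hdisj : (Finset.range r : Set ℕ).PairwiseDisjoint fun k => wordSphere d (k + 1) := by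
      intro k _ k' _ hkk
      refine Finset.disjoint_left.2 fun w hw hw' => hkk ?_
      have h1 := length_of_mem_wordSphere hw
      have h2 := length_of_mem_wordSphere hw'
      omega
    rw [← Finset.sum_biUnion hdisj]
    set T := (Finset.range r).biUnion fun k => wordSphere d (k + 1)
    have hT : ∀ w ∈ T, ∃ i u, w = i :: u ∧ i :: u ∈ wordBall d r := by
      intro w hw
      obtain ⟨k, hk, hw⟩ := Finset.mem_biUnion.1 hw
      have hl := length_of_mem_wordSphere hw
      cases w with
      | nil => simp at hl
      | cons i u =>
        exact ⟨i, u, rfl, wordSphere_subset_wordBall (by simpa using hk) hw⟩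
    have hedge : Set.InjOn (fun w => s(wordAct s w.tail v, wordAct s w v)) (T : Set _) := by
      intro w hw w' hw' h
      obtain ⟨i, u, rfl, hu⟩ := hT w hw
      obtain ⟨i', u', rfl, hu'⟩ := hT w' hw'
      simp only [List.tail_cons, Sym2.eq_iff] at h
      rcases h with ⟨-, h⟩ | ⟨h1, h2⟩
      · exact hinj hu hu' h
      · have e1 := hinj (cons_mem_wordBall.1 hu).1 hu' h1
        have e2 := hinj hu (cons_mem_wordBall.1 hu').1 h2
        have e1' := congrArg List.length e1
        have e2' := congrArg List.length e2
        simp only [List.length_cons] at e1' e2'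
        omega
    have h1 : ∑ w ∈ T, δ w ^ 2
        = ∑ e ∈ T.image fun w => s(wordAct s w.tail v, wordAct s w v), sqDiff f e := by
      rw [Finset.sum_image hedge]
      rfl
    rw [h1, involutionGraph, energy_ofFinset]
    refine Finset.sum_le_sum_of_subset_of_nonneg ?_ fun e _ _ => sqDiff_nonneg f e
    intro e he
    obtain ⟨w, hw, rfl⟩ := Finset.mem_image.1 he
    obtain ⟨i, u, rfl, -⟩ := hT w hw
    exact mem_involutionEdges s i (wordAct s u v)
  have hfin := htel r
  rw [hA0] at hfin
  refine hfin.trans (mul_le_mul (sum_inv_card_wordSphere_le hd r) hDE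
    (Finset.sum_nonneg fun k _ => hD0 k) ?_)
  have hd' : (3 : ℝ) ≤ d := by exact_mod_cast hd
  exact div_nonneg (by linarith) (mul_nonneg (by linarith) (by linarith))

/-- The graph of a family of involutions, with an additional root joined to the vertices of level
`0`. -/
def levelGraph (s : Fin d → V → V) (hne : ∀ i v, s i v ≠ v) (level : V → ℕ) :
    Multigraph (Option V) :=
  ((involutionGraph s hne).map Function.Embedding.some).union
    (spokes (Subtype.val : {v // level v = 0} → V))

theorem energy_levelGraph (s : Fin d → V → V) (hne : ∀ i v, s i v ≠ v) (level : V → ℕ)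
    (f : Option V → ℝ) : (levelGraph s hne level).energy f
      = (involutionGraph s hne).energy (fun v => f (some v))
        + ∑ v with level v = 0, (f none - f (some v)) ^ 2 := by
  simp only [levelGraph, energy_union, energy_map, energy_spokes]
  congr 1
  exact (Finset.sum_subtype (Finset.univ.filter fun v => level v = 0)
    (p := fun v => level v = 0) (by simp) fun v => (f none - f (some v)) ^ 2).symm

/-- Constants in the Poincaré inequality for the vertices of level `j`. -/
def levelConst (d : ℕ) : ℕ → ℝ
  | 0 => 1
  | j + 1 => d * (4 + 2 * levelConst d j)

theorem levelConst_nonneg (d j : ℕ) : 0 ≤ levelConst d j := by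
  induction j with
  | zero => exact zero_le_one
  | succ j ih => simp only [levelConst]; positivity

/-- A Poincaré inequality relative to the root, if every vertex of positive level has a neighbour
one level below. The constant does not depend on the number of vertices. -/
theorem sum_sq_sub_root_le {s : Fin d → V → V} (hs : ∀ i, Function.Involutive (s i))
    (hne : ∀ i v, s i v ≠ v) {level : V → ℕ}
    (hlevel : ∀ j v, level v = j + 1 → ∃ i, level (s i v) = j) {l : ℕ} (hl : ∀ v, level v ≤ l)
    (f : Option V → ℝ) :
    ∑ v, (f (some v) - f none) ^ 2
      ≤ (∑ j ∈ Finset.range (l + 1), levelConst d j) * (levelGraph s hne level).energy f := by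
  set E := (levelGraph s hne level).energy f with hE
  rw [energy_levelGraph] at hE
  have hE0 : 0 ≤ (involutionGraph s hne).energy (fun v => f (some v)) := energy_nonneg _ _
  have hE1 : 0 ≤ ∑ v with level v = 0, (f none - f (some v)) ^ 2 :=
    Finset.sum_nonneg fun _ _ => sq_nonneg _
  have key : ∀ j, ∑ v with level v = j, (f (some v) - f none) ^ 2 ≤ levelConst d j * E := by
    intro j
    induction j with
    | zero =>
      have : ∑ v with level v = 0, (f (some v) - f none) ^ 2
          = ∑ v with level v = 0, (f none - f (some v)) ^ 2 :=
        Finset.sum_congr rfl fun v _ => by ring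
      rw [this, levelConst]
      linarith
    | succ j ih =>
      have h1 : ∑ v with level v = j + 1, (f (some v) - f none) ^ 2
          ≤ ∑ v, ∑ i, if level (s i v) = j then (f (some v) - f none) ^ 2 else 0 := by
        rw [Finset.sum_filter]
        refine Finset.sum_le_sum fun v _ => ?_
        have hnn : ∀ i ∈ Finset.univ,
            0 ≤ if level (s i v) = j then (f (some v) - f none) ^ 2 else 0 := fun i _ => by
          split_ifs <;> positivity
        split_ifs with hv
        · obtain ⟨i, hi⟩ := hlevel j v hv
          have := Finset.single_le_sum hnn (Finset.mem_univ i)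
          rwa [if_pos hi] at this
        · exact Finset.sum_nonneg hnn
      have h2 : ∀ i, ∑ v, (if level (s i v) = j then (f (some v) - f none) ^ 2 else 0)
          ≤ 4 * E + 2 * (levelConst d j * E) := by
        intro i
        have h3 : ∑ v, (if level (s i v) = j then (f (some (s i v)) - f none) ^ 2 else 0)
            = ∑ v with level v = j, (f (some v) - f none) ^ 2 := by
          rw [Finset.sum_filter]
          exact (hs i).bijective.sum_comp
            fun v => if level v = j then (f (some v) - f none) ^ 2 else 0
        have h4 := sum_sq_sub_le_energy hne i fun v => f (some v)
        calc _ ≤ ∑ v, (2 * (f (some v) - f (some (s i v))) ^ 2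
              + 2 * if level (s i v) = j then (f (some (s i v)) - f none) ^ 2 else 0) := by
              refine Finset.sum_le_sum fun v _ => ?_
              split_ifs
              · nlinarith [sq_nonneg ((f (some v) - f (some (s i v)))
                  - (f (some (s i v)) - f none))]
              · positivity
          _ ≤ _ := by
              rw [Finset.sum_add_distrib, ← Finset.mul_sum, ← Finset.mul_sum, h3]
              linarith
      rw [Finset.sum_comm] at h1
      refine h1.trans ((Finset.sum_le_sum fun i _ => h2 i).trans (le_of_eq ?_))
      simp only [Finset.sum_const, Finset.card_univ, Fintype.card_fin, nsmul_eq_mul, levelConst]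
      ring
  have hfib := Finset.sum_fiberwise_of_maps_to (s := Finset.univ) (t := Finset.range (l + 1))
    (g := level) (fun v _ => Finset.mem_range.2 (Nat.lt_succ_of_le (hl v)))
    (fun v => (f (some v) - f none) ^ 2)
  rw [← hfib, Finset.sum_mul]
  exact Finset.sum_le_sum fun j _ => key j

/-- The flow from a vertex first spreads evenly over the sphere of radius `r` and then runs along
the levels to the root. If the sphere is large, the second part adds little. -/
theorem effectiveResistance_levelGraph_le (hd : 3 ≤ d) {s : Fin d → V → V}
    (hs : ∀ i, Function.Involutive (s i)) (hne : ∀ i v, s i v ≠ v) {level : V → ℕ}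
    (hlevel : ∀ j v, level v = j + 1 → ∃ i, level (s i v) = j) {l : ℕ} (hl : ∀ v, level v ≤ l)
    {r : ℕ} {v : V}
    (hinj : Set.InjOn (fun w => wordAct s w v) (wordBall d r : Set (List (Fin d)))) :
    (levelGraph s hne level).effectiveResistance none (some v) ≤ ENNReal.ofReal
      ((√(((d : ℝ) - 1) / (d * (d - 2)))
        + √((∑ j ∈ Finset.range (l + 1), levelConst d j) / (wordSphere d r).card)) ^ 2) := by
  set t := ((d : ℝ) - 1) / (d * (d - 2))
  set K := ∑ j ∈ Finset.range (l + 1), levelConst d j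
  set M := (wordSphere d r).card
  have hd' : (3 : ℝ) ≤ d := by exact_mod_cast hd
  have ht : 0 ≤ t := div_nonneg (by linarith) (mul_nonneg (by linarith) (by linarith))
  have hK : 0 ≤ K := Finset.sum_nonneg fun j _ => levelConst_nonneg d j
  have hM : (0 : ℝ) < M := by exact_mod_cast (Nat.zero_le r).trans_lt (lt_card_wordSphere hd r)
  refine effectiveResistance_le (by positivity) fun f => ?_
  set E := (levelGraph s hne level).energy f with hE
  have hE0 : 0 ≤ E := energy_nonneg _ _
  set A := (∑ w ∈ wordSphere d r, f (some (wordAct s w v))) / M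
  have h1 : (f (some v) - A) ^ 2 ≤ t * E := by
    refine (sq_sub_sphere_average_le hd hne hinj fun v => f (some v)).trans
      (mul_le_mul_of_nonneg_left ?_ ht)
    rw [hE, energy_levelGraph]
    exact le_add_of_nonneg_right (Finset.sum_nonneg fun _ _ => sq_nonneg _)
  have h2 : (A - f none) ^ 2 ≤ K / M * E := by
    have h3 : A - f none = (M : ℝ)⁻¹ * ∑ w ∈ wordSphere d r, (f (some (wordAct s w v)) - f none) := by
      simp only [A, Finset.sum_sub_distrib, Finset.sum_const, nsmul_eq_mul]
      change _ = (M : ℝ)⁻¹ * (_ - M * _)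
      field_simp
    have h4 := sq_sum_le_card_mul_sum_sq (s := wordSphere d r)
      (f := fun w => f (some (wordAct s w v)) - f none)
    have h5 : ∑ w ∈ wordSphere d r, (f (some (wordAct s w v)) - f none) ^ 2 ≤ K * E := by
      refine le_trans ?_ (sum_sq_sub_root_le hs hne hlevel hl f)
      rw [← Finset.sum_image (f := fun y => (f (some y) - f none) ^ 2)
        (hinj.mono (Finset.coe_subset.2 (wordSphere_subset_wordBall le_rfl)))]
      exact Finset.sum_le_sum_of_subset_of_nonneg (Finset.subset_univ _)
        fun _ _ _ => sq_nonneg _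
    rw [h3, mul_pow]
    calc _ ≤ ((M : ℝ)⁻¹) ^ 2 * (M * (K * E)) := by
          refine mul_le_mul_of_nonneg_left (h4.trans ?_) (by positivity)
          exact mul_le_mul_of_nonneg_left h5 hM.le
      _ = _ := by field_simp
  have h1' := Real.abs_le_sqrt h1
  have h2' := Real.abs_le_sqrt h2
  rw [Real.sqrt_mul ht] at h1'
  rw [Real.sqrt_mul (by positivity)] at h2'
  have h6 : |f none - f (some v)| ≤ (√t + √(K / M)) * √E := by
    rw [abs_sub_comm, ← sub_add_sub_cancel (f (some v)) A, add_mul]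
    exact (abs_add_le _ _).trans (add_le_add h1' h2')
  rw [← sq_abs, ← Real.sq_sqrt hE0, ← mul_pow]
  exact pow_le_pow_left₀ (abs_nonneg _) h6 2

end Coloured

/-! ### Graphs that look like the regular tree -/

section Construction

/-- The vertices of the graphs that realise the upper bound. The first factor makes the graph look
like the `d`-regular tree up to radius `r`; the second provides the levels, which are the lengths
of words. -/
abbrev TreeVertex (d r l : ℕ) : Type := Equiv.Perm (wordBall d r) × wordBall d l

variable {d : ℕ}

/-- The involutions whose graph realises the upper bound. -/
def treeMove (r l : ℕ) (i : Fin d) (v : TreeVertex d r l) : TreeVertex d r l :=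
  ((letterMove_involutive r i).toPerm * v.1, letterMove l i v.2)

theorem treeMove_involutive (r l : ℕ) (i : Fin d) : Function.Involutive (treeMove r l i) := by
  rintro ⟨g, x⟩
  refine Prod.ext (Equiv.ext fun y => ?_) (letterMove_involutive l i x)
  simp [treeMove, letterMove_involutive r i (g y)]

/-- Acting by a word `w` can be undone: apply the resulting permutation to a suitable point. -/
theorem wordAct_treeMove_apply {r l : ℕ} (v : TreeVertex d r l) {w : List (Fin d)}
    (hw : w ∈ wordBall d r) :
    (wordAct (treeMove r l) w v).1 (v.1⁻¹ ⟨[], nil_mem_wordBall r⟩) = ⟨w, hw⟩ := by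
  induction w with
  | nil => simp [wordAct]
  | cons i w ih =>
    have := ih (cons_mem_wordBall.1 hw).1
    rw [← letterMove_to_cons hw, ← this]
    rfl

/-- Around every vertex the `d`-regular tree is embedded up to radius `r`. -/
theorem injOn_wordAct_treeMove {r l : ℕ} (v : TreeVertex d r l) :
    Set.InjOn (fun w => wordAct (treeMove r l) w v) (wordBall d r : Set (List (Fin d))) := by
  intro w hw w' hw' h
  have h1 := wordAct_treeMove_apply v hw
  have h2 := wordAct_treeMove_apply v hw'
  simp only at h
  rw [h, h2] at h1
  exact (congrArg Subtype.val h1).symm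

theorem treeMove_ne {r l : ℕ} (hr : 1 ≤ r) (i : Fin d) (v : TreeVertex d r l) :
    treeMove r l i v ≠ v := by
  intro h
  have hi : [i] ∈ wordBall d r :=
    cons_mem_wordBall.2 ⟨nil_mem_wordBall r, by simp, hr⟩
  have := injOn_wordAct_treeMove v (Finset.mem_coe.2 hi) (Finset.mem_coe.2 (nil_mem_wordBall r)) h
  simp at this

theorem exists_treeMove_level {r l : ℕ} (j : ℕ) (v : TreeVertex d r l)
    (h : v.2.1.length = j + 1) : ∃ i, (treeMove r l i v).2.1.length = j := by
  obtain ⟨g, ⟨w, hw⟩⟩ := v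
  cases w with
  | nil => simp at h
  | cons i w =>
    refine ⟨i, ?_⟩
    simp only [treeMove, letterMove_of_cons hw]
    simpa using h

/-- The bound on `b(α)` that one graph gives. The last term accounts for the leaves that pay for the
edges between the root and the vertices of level `0`. -/
theorem le_add_of_le_bTotal (hd : 3 ≤ d) {β : ℝ} (hβ : 0 ≤ β)
    (hle : ∀ n : ℕ, n * ENNReal.ofReal β ≤ bTotal n d) {r : ℕ} (hr : 1 ≤ r) (l : ℕ) :
    β ≤ (√(((d : ℝ) - 1) / (d * (d - 2)))
        + √((∑ j ∈ Finset.range (l + 1), levelConst d j) / (wordSphere d r).card)) ^ 2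
      + 2 / (wordSphere d l).card := by
  set c := (√(((d : ℝ) - 1) / (d * (d - 2)))
        + √((∑ j ∈ Finset.range (l + 1), levelConst d j) / (wordSphere d r).card)) ^ 2
  set p := Fintype.card (Equiv.Perm (wordBall d r))
  set q := (wordBall d l).card
  have hp : (0 : ℝ) < p := by exact_mod_cast Fintype.card_pos
  have hq : 0 < q := Finset.card_pos.2 ⟨_, nil_mem_wordBall l⟩
  have hV : Fintype.card (TreeVertex d r l) = p * q := by
    simp [TreeVertex, p, q]
  let level : TreeVertex d r l → ℕ := fun v => v.2.1.length
  have hS : Fintype.card {v // level v = 0} = p := by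
    refine Fintype.card_congr ⟨fun v => v.1.1, fun g => ⟨(g, ⟨[], nil_mem_wordBall l⟩), rfl⟩, ?_, ?_⟩
    · rintro ⟨⟨g, ⟨w, hw⟩⟩, h⟩
      obtain rfl : w = [] := List.length_eq_zero_iff.1 h
      rfl
    · intro g; rfl
  set G := levelGraph (treeMove r l) (treeMove_ne hr) level
  have hedges : (G.edgeCount : ℝ) ≤ d * (p * q : ℕ) / 2 + p := by
    have h1 := two_mul_edgeCount_involutionGraph_le (treeMove_involutive r l)
      (treeMove_ne (d := d) (l := l) hr)
    rw [hV] at h1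
    have h2 : (2 : ℝ) * (involutionGraph (treeMove r l) (treeMove_ne (d := d) (l := l) hr)).edgeCount
        ≤ d * (p * q : ℕ) := by exact_mod_cast h1
    simp only [G, levelGraph, edgeCount_union, edgeCount_map, edgeCount_spokes, hS, Nat.cast_add]
    linarith
  have hR : ∀ v, G.effectiveResistance none (some v) ≤ ENNReal.ofReal c := fun v =>
    effectiveResistance_levelGraph_le hd (treeMove_involutive r l) (treeMove_ne hr)
      exists_treeMove_level (fun v => (mem_wordBall.1 v.2.2).2) (injOn_wordAct_treeMove v)
  have hmain := (hle (p * q + 2 * p)).trans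
    ((bTotal_le_of_surplus (by exact_mod_cast hd) G hV hedges).trans
      (add_le_add_left (Finset.sum_le_sum fun v _ => hR v) _))
  rw [Finset.sum_const, Finset.card_univ, hV, nsmul_eq_mul] at hmain
  have h2p : (2 : ℝ≥0∞) * p = ENNReal.ofReal (2 * p) := by
    rw [ENNReal.ofReal_mul zero_le_two]; simp
  have hc : 0 ≤ c := sq_nonneg _
  rw [h2p, ← ENNReal.ofReal_natCast, ← ENNReal.ofReal_natCast (p * q),
    ← ENNReal.ofReal_mul (Nat.cast_nonneg _), ← ENNReal.ofReal_mul (Nat.cast_nonneg _),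
    ← ENNReal.ofReal_add (by positivity) (by positivity),
    ENNReal.ofReal_le_ofReal_iff (by positivity)] at hmain
  push_cast at hmain
  have hq' : (0 : ℝ) < q := by exact_mod_cast hq
  have h3 : (p * q : ℝ) * β ≤ (p * q : ℝ) * (c + 2 / q) := by
    have e : (p * q : ℝ) * (c + 2 / q) = p * q * c + 2 * p := by field_simp
    rw [e]
    have : 0 ≤ 2 * (p : ℝ) * β := by positivity
    linarith
  have h4 := le_of_mul_le_mul_left h3 (by positivity)
  have h5 : (2 : ℝ) / q ≤ 2 / (wordSphere d l).card := by
    have h6 : (0 : ℝ) < (wordSphere d l).card := by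
      exact_mod_cast (Nat.zero_le l).trans_lt (lt_card_wordSphere hd l)
    refine div_le_div_of_nonneg_left zero_le_two h6 ?_
    exact_mod_cast Finset.card_le_card (wordSphere_subset_wordBall le_rfl)
  linarith

theorem le_tree_resistance (hd : 3 ≤ d) {β : ℝ} (hβ : 0 ≤ β)
    (hle : ∀ n : ℕ, n * ENNReal.ofReal β ≤ bTotal n d) :
    β ≤ ((d : ℝ) - 1) / (d * (d - 2)) := by
  have hd' : (3 : ℝ) ≤ d := by exact_mod_cast hd
  have ht : 0 ≤ ((d : ℝ) - 1) / (d * (d - 2)) :=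
    div_nonneg (by linarith) (mul_nonneg (by linarith) (by linarith))
  have hM : Tendsto (fun k => ((wordSphere d k).card : ℝ)) atTop atTop :=
    tendsto_atTop_mono (fun k => by exact_mod_cast (lt_card_wordSphere hd k).le)
      tendsto_natCast_atTop_atTop
  have h1 : ∀ l, β ≤ ((d : ℝ) - 1) / (d * (d - 2)) + 2 / (wordSphere d l).card := by
    intro l
    have hlim : Tendsto (fun r => (√(((d : ℝ) - 1) / (d * (d - 2)))
        + √((∑ j ∈ Finset.range (l + 1), levelConst d j) / (wordSphere d r).card)) ^ 2
        + 2 / (wordSphere d l).card) atTop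
        (𝓝 ((√(((d : ℝ) - 1) / (d * (d - 2))) + √0) ^ 2 + 2 / (wordSphere d l).card)) :=
      ((((Real.continuous_sqrt.tendsto 0).comp (hM.const_div_atTop _)).const_add _).pow 2).add_const _
    rw [Real.sqrt_zero, add_zero, Real.sq_sqrt ht] at hlim
    refine ge_of_tendsto hlim ?_
    filter_upwards [eventually_ge_atTop 1] with r hr
    exact le_add_of_le_bTotal hd hβ hle hr l
  have hlim : Tendsto (fun l => ((d : ℝ) - 1) / (d * (d - 2)) + 2 / ((wordSphere d l).card : ℝ))
      atTop (𝓝 (((d : ℝ) - 1) / (d * (d - 2)) + 0)) := (hM.const_div_atTop _).const_add _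
  rw [add_zero] at hlim
  exact ge_of_tendsto' hlim h1

end Construction

end ResistorNetwork

theorem corollary6p4 (α : ℕ) (hα : 3 ≤ α) :
    (Tendsto (fun n : ℕ => ResistorNetwork.bSeq n (α : ℝ)) atTop (𝓝 (ResistorNetwork.b (α : ℝ))) ∧
      ResistorNetwork.b (α : ℝ) ≤
        ENNReal.ofReal (((α : ℝ) - 1) / ((α : ℝ) * ((α : ℝ) - 2)))) ∧
    (Tendsto (fun n : ℕ => ResistorNetwork.aSeq n (α : ℝ)) atTop (𝓝 (ResistorNetwork.a (α : ℝ))) ∧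
      ResistorNetwork.a (α : ℝ) ≤
        ENNReal.ofReal (2 * ((α : ℝ) - 1) / ((α : ℝ) * ((α : ℝ) - 2)))) := by
  have hα' : (3 : ℝ) ≤ α := by exact_mod_cast hα
  obtain ⟨β, hβ, hb, hle⟩ := ResistorNetwork.exists_tendsto_bSeq (by linarith : (2 : ℝ) ≤ α)
  have ha := ResistorNetwork.tendsto_aSeq hα' hβ hb hle
  have hbound := ResistorNetwork.le_tree_resistance hα hβ hle
  have hb' : ResistorNetwork.b α = ENNReal.ofReal β := hb.limUnder_eq
  have ha' : ResistorNetwork.a α = ENNReal.ofReal (2 * β) := ha.limUnder_eq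
  rw [hb', ha', mul_div_assoc]
  exact ⟨⟨hb, ENNReal.ofReal_le_ofReal hbound⟩,
    ⟨ha, ENNReal.ofReal_le_ofReal (mul_le_mul_of_nonneg_left hbound zero_le_two)⟩⟩
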